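/- Let $d\ge 1$, let $D_d$ be the dihedral group of order $2d$, and let $Q$ be a quasigroup of order $2d$. For a finite group $G$ with set $\widetilde\Gamma$ of irreducible complex characters, a quasigroup $Q$ is a *balanced cover* of $G$ if there is a surjection $f:Q\to\widetilde\Gamma$ with $|f^{-1}\{\theta\}|=\theta(1)^2$ for all $\theta\in\widetilde\Gamma$, with $$\big|\{(p,q)\in f^{-1}\{\theta_1\}\times f^{-1}\{\theta_2\} : f(p q)=\theta_3\}\big|=\theta_1(1)\theta_2(1)\theta_3(1)\langle\theta_1\theta_2|\theta_3\rangle\qquad(\theta_1,\theta_2,\theta_3\in\widetilde\Gamma),$$ where $\langle\theta|\varphi\rangle=\frac1{|G|}\sum_{g\in G}\theta(g)\overline{\varphi(g)}$, and such that, for all $\theta_1,\theta_2,\theta_3$, the number of $(p,p')\in f^{-1}\{\theta_1\}\times f^{-1}\{\theta_2\}$ with $pp'=q$ is the same for all $q\in f^{-1}\{\theta_3\}$. Let $\{\pm1\}$ act on $\mathbb Z/d$ by multiplication, and let $I\subseteq\mathbb Z/d$ be a set of distinct representatives of the orbits. For $a\in\mathbb Z/d$ let $r_a$ be the size of the orbit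 $\{a,-a\}$ and $s_a=|\{j\in\{0,1\}: a(-1)^j=a\}|=2/r_a$. **Theorem.** $Q$ is a balanced cover of $D_d$ if and only if there exist pairwise disjoint subsets $S_{a,\alpha}\subseteq Q$, for $a\in I$ and $0\le\alpha<s_a$, with $|S_{a,\alpha}|=r_a^2$, such that for all $a,b\in I$, $0\le\alpha<s_a$, $0\le\beta<s_b$, $$S_{a,\alpha}\cdot S_{b,\beta}=r_a\gcd(r_a,r_b)\sum_{i=0}^{r_b-1}\ \sum_{\gamma}\frac{S_{a+b(-1)^i,\gamma}}{r_{a+b(-1)^i}} .$$ Here subsets of $Q$ are identified with the sums of their elements in the quasigroup algebra $\mathbb QQ$; for $c\in\mathbb Z/d$ outside $I$, $S_{c,\gamma}$ means $S_{c',\gamma}$ with $c'\in I$ the representative of the orbit of $c$; and the inner sum is over all $0\le\gamma<s_{c}$, $c=a+b(-1)^i$, with $$\alpha+\beta-\gamma\equiv\{al/d\}+\{bl/d\}-\{cl/d\}\pmod{\gcd(s_a,s_b)},\qquad l=0,$$ where $\{x\}$ is the fractional part of $x$; that is, $\alpha+\beta\equiv\gamma\pmod{\gcd(s_a,s_b)}$.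 -/

import Mathlib

open scoped BigOperators

/-! ### Quasigroups -/

/-- A (combinatorial) quasigroup: a set with a binary operation for which `a * x = b` and
`y * a = b` are uniquely solvable. -/
class IsQuasigroup (Q : Type*) [Mul Q] : Prop where
  existsUnique_left : ∀ a b : Q, ∃! x : Q, a * x = b
  existsUnique_right : ∀ a b : Q, ∃! y : Q, y * a = b

/-- `m_q(S, T)`: the multiplicity of `q` in the product of the subsets `S` and `T`. -/
noncomputable def prodMult {Q : Type*} [Mul Q] (q : Q) (S T : Set Q) : ℕ :=
  {p : Q × Q | p.1 ∈ S ∧ p.2 ∈ T ∧ p.1 * p.2 = q}.ncard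

/-- A finite subset `S` of `Q` regarded as the element `∑ q ∈ S, q` of the rational quasigroup
algebra `ℚQ` (the free `ℚ`-module on `Q` with product extending that of `Q` bilinearly). -/
noncomputable def subsetSum {Q : Type*} (S : Finset Q) : MonoidAlgebra ℚ Q :=
  ∑ q ∈ S, MonoidAlgebra.single q 1

/-! ### Irreducible characters and character quasigroups of a finite group -/

/-- The set of irreducible complex characters of `G`. -/
def irredChars (G : Type*) [Group G] : Set (G → ℂ) :=
  {χ | ∃ (V : Type) (_ : AddCommGroup V) (_ : Module ℂ V) (_ : FiniteDimensional ℂ V)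
      (ρ : Representation ℂ G V), ρ.IsIrreducible ∧ ρ.character = χ}

/-- The scalar product `⟨θ|φ⟩ = |G|⁻¹ ∑_g θ(g) conj(φ(g))` of functions on a finite group. -/
noncomputable def charInner {G : Type*} [Fintype G] (θ φ : G → ℂ) : ℂ :=
  (Fintype.card G : ℂ)⁻¹ * ∑ g : G, θ g * (starRingEnd ℂ) (φ g)

/-- The weight `θ(1)²` of the weighted character quasigroup. -/
def charWeight {G : Type*} [Group G] (θ : irredChars G) : ℂ :=
  (θ : G → ℂ) 1 ^ 2

/-- The multiplication function `θ₁(1) θ₂(1) θ₃(1) ⟨θ₁θ₂|θ₃⟩` of the weighted character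
quasigroup. -/
noncomputable def charMult {G : Type*} [Group G] [Fintype G] (θ₁ θ₂ θ₃ : irredChars G) : ℂ :=
  (θ₁ : G → ℂ) 1 * (θ₂ : G → ℂ) 1 * (θ₃ : G → ℂ) 1 *
    charInner ((θ₁ : G → ℂ) * (θ₂ : G → ℂ)) (θ₃ : G → ℂ)

/-- `f` is a covering of the weighted character quasigroup of `G` by the quasigroup `Q`: it is
surjective, its fibres have the sizes prescribed by the weights, and the number of products of
elements of two fibres that land in a third one is prescribed by the multiplication function.
(The weights and the values of the multiplication function are natural numbers, written here as
complex numbers.) -/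
structure IsCharCovering (G : Type*) [Group G] [Fintype G] {Q : Type*} [Mul Q]
    (f : Q → irredChars G) : Prop where
  surjective : Function.Surjective f
  weight : ∀ θ : irredChars G, ((f ⁻¹' {θ}).ncard : ℂ) = charWeight θ
  mult : ∀ θ₁ θ₂ θ₃ : irredChars G,
    (({p : Q × Q | f p.1 = θ₁ ∧ f p.2 = θ₂ ∧ f (p.1 * p.2) = θ₃}.ncard : ℕ) : ℂ) =
      charMult θ₁ θ₂ θ₃

/-- `Q` is a balanced cover of `G`: there is a covering of the weighted character quasigroup of
`G` such that, with `S_θ` the fibre over `θ`, the multiplicity `m_q(S_θ₁, S_θ₂)` is the same for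
all `q ∈ S_θ₃`. -/
def IsBalancedCover (Q : Type*) [Mul Q] (G : Type*) [Group G] [Fintype G] : Prop :=
  ∃ f : Q → irredChars G, IsCharCovering G f ∧
    ∀ θ₁ θ₂ θ₃ : irredChars G, ∀ q ∈ f ⁻¹' {θ₃}, ∀ q' ∈ f ⁻¹' {θ₃},
      prodMult q (f ⁻¹' {θ₁}) (f ⁻¹' {θ₂}) = prodMult q' (f ⁻¹' {θ₁}) (f ⁻¹' {θ₂})

/-! ### Orbit data of the metacyclic group
`M(k, l, m, n) = ⟨x, y | y ^ m = x ^ l, x ^ n = 1, y⁻¹ x y = x ^ k⟩`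

Here `y` acts on `ℤ/n` as multiplication by `k`, and `y ^ m` acts trivially. -/

/-- The orbit `{a k ^ j}` of `a ∈ ℤ/n`. -/
def metaOrbit (k : ℤ) {n : ℕ} (a : ZMod n) : Set (ZMod n) :=
  Set.range fun j : ℕ => a * (k : ZMod n) ^ j

/-- `r_a`, the size of the orbit of `a`. -/
noncomputable def orbSize (k : ℤ) {n : ℕ} (a : ZMod n) : ℕ :=
  (metaOrbit k a).ncard

/-- `s_a`, the number of those `y ^ j`, `0 ≤ j < m`, that stabilize `a`. -/
def stabSize (k : ℤ) (m : ℕ) {n : ℕ} (a : ZMod n) : ℕ :=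
  ((Finset.range m).filter fun j => a * (k : ZMod n) ^ j = a).card

/-- `I` is a set of distinct representatives for the orbits. -/
def IsOrbitReps (k : ℤ) {n : ℕ} (I : Set (ZMod n)) : Prop :=
  ∀ x : ZMod n, ∃! a : ZMod n, a ∈ I ∧ a ∈ metaOrbit k x

/-- The element of `I` that represents the orbit of `x`. -/
noncomputable def IsOrbitReps.rep {k : ℤ} {n : ℕ} {I : Set (ZMod n)} (hI : IsOrbitReps k I)
    (x : ZMod n) : I :=
  ⟨(hI x).choose, (hI x).choose_spec.1.1⟩

/-- The fractional part `{a l / n}`; it does not depend on the integer representing `a`. -/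
def fracPart (l : ℤ) {n : ℕ} (a : ZMod n) : ℚ :=
  Int.fract (((a.val : ℚ) * (l : ℚ)) / (n : ℚ))

/-- The congruence
`α + β - γ ≡ {a l / n} + {b l / n} - {c l / n}  mod gcd(s_a, s_b)`. -/
def GammaCond (k l : ℤ) (m : ℕ) {n : ℕ} (a b c : ZMod n) (α β γ : ℕ) : Prop :=
  ∃ t : ℤ, ((α : ℚ) + (β : ℚ) - (γ : ℚ)) - (fracPart l a + fracPart l b - fracPart l c) =
    (t : ℚ) * (Nat.gcd (stabSize k m a) (stabSize k m b) : ℚ)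

/-- The index set of pairs `(a, α)` with `a ∈ I` and `0 ≤ α < s_a`. -/
abbrev CharIndex (k : ℤ) (m : ℕ) {n : ℕ} (I : Set (ZMod n)) : Type :=
  Σ a : I, Fin (stabSize k m (a : ZMod n))

/-! ### Balanced covers as labellings -/

/-! A balanced cover is a labelling of `Q` by irreducible characters. Balance says that the
multiplicity of `q` in a product of two fibres depends only on the label of `q`; the covering
condition then fixes it as `charMult` divided by the size `θ₃(1)²` of the third fibre. Comparing
coefficients in `ℚQ` turns this into one product formula per pair of fibres
(`isBalancedCover_iff_exists_subsets`). It remains to compute for `D_d`. The functions `orbitChar a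
α` are irreducible characters. Weighted by degree they add up to the regular character, so nothing
is orthogonal to all of them and the list is complete (`exists_eq_orbitChar`). Multiplying additive
characters of `ℤ/d` decomposes their products (`orbitChar_mul_orbitChar`), and orthonormality reads
off the structure constants (`charMult_orbitCharEquiv`). -/

theorem coeff_subsetSum_mul_subsetSum {Q : Type*} [Mul Q] (S T : Finset Q) (q : Q) :
    (subsetSum S * subsetSum T).coeff q = (prodMult q (S : Set Q) (T : Set Q) : ℚ) := by
  classical
  have hset : {p : Q × Q | p.1 ∈ (S : Set Q) ∧ p.2 ∈ (T : Set Q) ∧ p.1 * p.2 = q} =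
      (((S ×ˢ T).filter fun p => p.1 * p.2 = q : Finset (Q × Q)) : Set (Q × Q)) := by
    ext p
    simp [and_assoc]
  rw [prodMult, hset, Set.ncard_coe_finset, Finset.card_filter, Finset.sum_product]
  simp [subsetSum, Finset.sum_mul_sum, MonoidAlgebra.single_mul_single, Finsupp.single_apply,
    Finsupp.finsetSum_apply]

theorem coeff_subsetSum {Q : Type*} [DecidableEq Q] (S : Finset Q) (q : Q) :
    (subsetSum S).coeff q = if q ∈ S then 1 else 0 := by
  simp [subsetSum, Finsupp.single_apply, Finsupp.finsetSum_apply]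

theorem coeff_sum_smul_subsetSum_fiber {Q ι : Type*} [Fintype Q] [Fintype ι]
    [DecidableEq ι] (f : Q → ι) (c : ι → ℚ) (q : Q) :
    (∑ k, c k • subsetSum (Finset.univ.filter fun x => f x = k)).coeff q = c (f q) := by
  classical
  simp [Finsupp.finsetSum_apply, coeff_subsetSum]

/-- Sorting the pairs by their product links the covering condition to multiplicities: under balance
the summands on the right are all equal. -/
theorem ncard_fiber_triples {Q ι : Type*} [Mul Q] [Fintype Q] [DecidableEq ι]
    (f : Q → ι) (i j k : ι) :
    {p : Q × Q | f p.1 = i ∧ f p.2 = j ∧ f (p.1 * p.2) = k}.ncard =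
      ∑ q ∈ Finset.univ.filter (fun q => f q = k), prodMult q (f ⁻¹' {i}) (f ⁻¹' {j}) := by
  classical
  have h1 : {p : Q × Q | f p.1 = i ∧ f p.2 = j ∧ f (p.1 * p.2) = k} =
      ((Finset.univ.filter fun p : Q × Q => f p.1 = i ∧ f p.2 = j ∧ f (p.1 * p.2) = k :
        Finset (Q × Q)) : Set (Q × Q)) := by
    ext; simp
  have h2 (q : Q) : prodMult q (f ⁻¹' {i}) (f ⁻¹' {j}) =
      (Finset.univ.filter fun p : Q × Q => f p.1 = i ∧ f p.2 = j ∧ p.1 * p.2 = q).card := by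
    rw [prodMult, ← Set.ncard_coe_finset]
    congr 1
    ext; simp
  rw [h1, Set.ncard_coe_finset, Finset.card_eq_sum_card_fiberwise (f := fun p => p.1 * p.2)
    (t := Finset.univ.filter fun q => f q = k)]
  · refine Finset.sum_congr rfl fun q hq => ?_
    rw [h2, Finset.filter_filter]
    congr 1
    ext p
    simp only [Finset.mem_filter, Finset.mem_univ, true_and] at hq ⊢
    constructor
    · rintro ⟨⟨a, b, -⟩, d⟩
      exact ⟨a, b, d⟩
    · rintro ⟨a, b, d⟩
      exact ⟨⟨a, b, by rw [d, hq]⟩, d⟩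
  · intro p hp
    simp at hp ⊢
    exact hp.2.2

/-- A balanced cover is a labelling of the quasigroup by an index set of the irreducible
characters in which every multiplicity depends only on the three labels, in the way prescribed
by the characters. -/
theorem isBalancedCover_iff_exists_labelling {G : Type*} [Group G] [Fintype G] {Q : Type*} [Mul Q]
    [Fintype Q] {ι : Type*} [DecidableEq ι] (e : ι ≃ irredChars G) (deg : ι → ℕ)
    (hdeg : ∀ i, 0 < deg i) (h1 : ∀ i, (e i : G → ℂ) 1 = deg i) (c : ι → ι → ι → ℚ)
    (hc : ∀ i j k, charMult (e i) (e j) (e k) = ((c i j k * deg k ^ 2 : ℚ) : ℂ)) :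
    IsBalancedCover Q G ↔ ∃ f : Q → ι,
      (∀ k, (Finset.univ.filter fun x => f x = k).card = deg k ^ 2) ∧
      ∀ i j q, (prodMult q (f ⁻¹' {i}) (f ⁻¹' {j}) : ℚ) = c i j (f q) := by
  have hpre (f : Q → ι) (k : ι) : (fun x => e (f x)) ⁻¹' {e k} = f ⁻¹' {k} := by
    ext; simp
  have hncard (f : Q → ι) (k : ι) :
      (f ⁻¹' {k}).ncard = (Finset.univ.filter fun x => f x = k).card := by
    rw [← Set.ncard_coe_finset]
    congr 1
    ext; simp
  constructor
  · rintro ⟨f', hf', hbal⟩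
    obtain ⟨f, rfl⟩ : ∃ f : Q → ι, f' = fun x => e (f x) :=
      ⟨fun x => e.symm (f' x), by simp⟩
    have hw (k : ι) : (Finset.univ.filter fun x => f x = k).card = deg k ^ 2 := by
      have := hf'.weight (e k)
      rw [hpre, charWeight, h1, hncard] at this
      exact_mod_cast this
    refine ⟨f, hw, fun i j q => ?_⟩
    have hm := hf'.mult (e i) (e j) (e (f q))
    simp only [EmbeddingLike.apply_eq_iff_eq] at hm
    -- By balance the sum over the fibre is `deg ^ 2` equal terms, and `deg ^ 2` cancels.
    rw [hc, ncard_fiber_triples, Finset.sum_congr rfl (g := fun _ =>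
      prodMult q (f ⁻¹' {i}) (f ⁻¹' {j})), Finset.sum_const, hw] at hm
    · have hd : ((deg (f q) : ℚ)) ≠ 0 := by exact_mod_cast (hdeg _).ne'
      have hm' : ((deg (f q) ^ 2 • prodMult q (f ⁻¹' {i}) (f ⁻¹' {j}) : ℕ) : ℚ) =
        c i j (f q) * deg (f q) ^ 2 := by exact_mod_cast hm
      push_cast [smul_eq_mul] at hm'
      rw [mul_comm] at hm'
      exact mul_right_cancel₀ (pow_ne_zero 2 hd) hm'
    · intro q' hq'
      have := hbal (e i) (e j) (e (f q)) q' (by simpa using hq') q (by simp)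
      simpa only [hpre] using this
  · rintro ⟨f, hw, hm⟩
    refine ⟨fun x => e (f x), ⟨?_, ?_, ?_⟩, ?_⟩
    · intro θ
      have : (Finset.univ.filter fun x => f x = e.symm θ).Nonempty := by
        rw [← Finset.card_pos, hw]
        exact pow_pos (hdeg _) 2
      obtain ⟨x, hx⟩ := this
      exact ⟨x, by simpa [Equiv.eq_symm_apply] using hx⟩
    · intro θ
      obtain ⟨k, rfl⟩ := e.surjective θ
      rw [hpre, charWeight, h1, hncard, hw]
      norm_cast
    · intro θ₁ θ₂ θ₃
      obtain ⟨i, rfl⟩ := e.surjective θ₁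
      obtain ⟨j, rfl⟩ := e.surjective θ₂
      obtain ⟨k, rfl⟩ := e.surjective θ₃
      simp only [EmbeddingLike.apply_eq_iff_eq]
      rw [hc, ncard_fiber_triples]
      have : ((∑ q ∈ Finset.univ.filter (fun q => f q = k),
          prodMult q (f ⁻¹' {i}) (f ⁻¹' {j}) : ℕ) : ℚ) = c i j k * deg k ^ 2 := by
        push_cast
        rw [Finset.sum_congr rfl (g := fun _ => c i j k), Finset.sum_const, hw]
        · simp [mul_comm]
        · intro q hq
          rw [hm, (Finset.mem_filter.1 hq).2]
      exact_mod_cast congrArg (Rat.cast : ℚ → ℂ) this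
    · intro θ₁ θ₂ θ₃ q hq q' hq'
      obtain ⟨i, rfl⟩ := e.surjective θ₁
      obtain ⟨j, rfl⟩ := e.surjective θ₂
      have hqq : f q = f q' := e.injective (hq.trans hq'.symm)
      rw [hpre, hpre]
      have := (hm i j q).trans ((congrArg _ hqq).trans (hm i j q').symm)
      exact_mod_cast this

/-- The labelling of a finite set by pairwise disjoint subsets whose sizes add up to the size of
the whole set. -/
theorem exists_labelling_of_pairwise_disjoint {Q ι : Type*} [Fintype Q] [Fintype ι]
    [DecidableEq ι] (S : ι → Finset Q) (hS : Pairwise fun i j => Disjoint (S i) (S j))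
    (hcard : ∑ i, (S i).card = Fintype.card Q) :
    ∃ f : Q → ι, ∀ k, S k = Finset.univ.filter fun x => f x = k := by
  classical
  have hU : Finset.univ.biUnion S = Finset.univ := by
    rw [← Finset.card_eq_iff_eq_univ, Finset.card_biUnion fun i _ j _ h => hS h, hcard]
  have hex (x : Q) : ∃ i, x ∈ S i := by
    have := Finset.mem_univ x
    rw [← hU] at this
    simpa using this
  choose f hf using hex
  refine ⟨f, fun k => ?_⟩
  ext x
  simp only [Finset.mem_filter, Finset.mem_univ, true_and]
  constructor
  · intro hx
    by_contra hne
    exact Finset.disjoint_left.1 (hS hne) (hf x) hx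
  · rintro rfl
    exact hf x

/-- By `hcard` disjoint subsets of the prescribed sizes exhaust `Q`, hence are the fibres of a
labelling; the coefficient of `q` on the right is then `c i j (f q)`. -/
theorem isBalancedCover_iff_exists_subsets {G : Type*} [Group G] [Fintype G] {Q : Type*} [Mul Q]
    [Fintype Q] {ι : Type*} [Fintype ι] [DecidableEq ι] (e : ι ≃ irredChars G) (deg : ι → ℕ)
    (hdeg : ∀ i, 0 < deg i) (h1 : ∀ i, (e i : G → ℂ) 1 = deg i)
    (hcard : ∑ i, deg i ^ 2 = Fintype.card Q) (c : ι → ι → ι → ℚ)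
    (hc : ∀ i j k, charMult (e i) (e j) (e k) = ((c i j k * deg k ^ 2 : ℚ) : ℂ)) :
    IsBalancedCover Q G ↔ ∃ S : ι → Finset Q, (Pairwise fun i j => Disjoint (S i) (S j)) ∧
      (∀ i, (S i).card = deg i ^ 2) ∧
      ∀ i j, subsetSum (S i) * subsetSum (S j) = ∑ k, c i j k • subsetSum (S k) := by
  rw [isBalancedCover_iff_exists_labelling e deg hdeg h1 c hc]
  have hcoe (f : Q → ι) (k : ι) :
      ((Finset.univ.filter fun x => f x = k : Finset Q) : Set Q) = f ⁻¹' {k} := by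
    ext; simp
  constructor
  · rintro ⟨f, hw, hm⟩
    refine ⟨fun k => Finset.univ.filter fun x => f x = k, ?_, hw, fun i j => ?_⟩
    · intro i j hij
      refine Finset.disjoint_filter.2 fun x _ hx hx' => hij (hx.symm.trans hx')
    · ext q
      rw [coeff_subsetSum_mul_subsetSum, coeff_sum_smul_subsetSum_fiber, hcoe, hcoe, hm]
  · rintro ⟨S, hS, hw, hm⟩
    obtain ⟨f, hf⟩ := exists_labelling_of_pairwise_disjoint S hS (by simpa only [hw] using hcard)
    obtain rfl : S = fun k => Finset.univ.filter fun x => f x = k := funext hf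
    refine ⟨f, hw, fun i j q => ?_⟩
    have := congrArg (fun x : MonoidAlgebra ℚ Q => x.coeff q) (hm i j)
    simpa only [coeff_subsetSum_mul_subsetSum, coeff_sum_smul_subsetSum_fiber, hcoe] using this

/-! ### Orbits of `±1` on `ℤ/d` -/

theorem mem_metaOrbit_neg_one {d : ℕ} {a x : ZMod d} :
    x ∈ metaOrbit (-1) a ↔ x = a ∨ x = -a := by
  simp only [metaOrbit, Set.mem_range, Int.cast_neg, Int.cast_one]
  constructor
  · rintro ⟨j, rfl⟩
    rcases neg_one_pow_eq_or (ZMod d) j with h | h <;> simp [h]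
  · rintro (rfl | rfl)
    · exact ⟨0, by simp⟩
    · exact ⟨1, by simp⟩

theorem metaOrbit_neg_one {d : ℕ} (a : ZMod d) : metaOrbit (-1) a = {a, -a} := by
  ext x
  simp [mem_metaOrbit_neg_one]

theorem orbSize_neg_one_of_neg_eq {d : ℕ} {a : ZMod d} (h : -a = a) : orbSize (-1) a = 1 := by
  simp [orbSize, metaOrbit_neg_one, h]

theorem orbSize_neg_one_of_neg_ne {d : ℕ} {a : ZMod d} (h : -a ≠ a) : orbSize (-1) a = 2 := by
  rw [orbSize, metaOrbit_neg_one, Set.ncard_pair h.symm]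

theorem stabSize_neg_one_of_neg_eq {d : ℕ} {a : ZMod d} (h : -a = a) :
    stabSize (-1) 2 a = 2 := by
  simp [stabSize, Finset.range_add_one, Finset.filter_insert, Finset.filter_singleton, h]

theorem stabSize_neg_one_of_neg_ne {d : ℕ} {a : ZMod d} (h : -a ≠ a) :
    stabSize (-1) 2 a = 1 := by
  simp [stabSize, Finset.range_add_one, Finset.filter_insert, Finset.filter_singleton, h]

theorem orbSize_neg_one_pos {d : ℕ} (a : ZMod d) : 0 < orbSize (-1) a := by
  by_cases h : -a = a
  · simp [orbSize_neg_one_of_neg_eq h]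
  · simp [orbSize_neg_one_of_neg_ne h]

theorem stabSize_mul_orbSize_neg_one {d : ℕ} (a : ZMod d) :
    stabSize (-1) 2 a * orbSize (-1) a = 2 := by
  by_cases h : -a = a
  · rw [orbSize_neg_one_of_neg_eq h, stabSize_neg_one_of_neg_eq h]
  · rw [orbSize_neg_one_of_neg_ne h, stabSize_neg_one_of_neg_ne h]

theorem IsOrbitReps.rep_eq_or_neg {d : ℕ} {I : Set (ZMod d)} (hI : IsOrbitReps (-1) I)
    (x : ZMod d) : (hI.rep x : ZMod d) = x ∨ (hI.rep x : ZMod d) = -x :=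
  mem_metaOrbit_neg_one.1 (hI x).choose_spec.1.2

theorem IsOrbitReps.eq_rep {d : ℕ} {I : Set (ZMod d)} (hI : IsOrbitReps (-1) I)
    {x : ZMod d} {a : I} (h : (a : ZMod d) = x ∨ (a : ZMod d) = -x) : a = hI.rep x :=
  Subtype.ext ((hI x).choose_spec.2 _ ⟨a.2, mem_metaOrbit_neg_one.2 h⟩)

/-- A sum of an even function over `ℤ/d` as a sum over representatives of the orbits of `±1`. -/
theorem IsOrbitReps.sum_orbSize_mul {d : ℕ} [NeZero d] {I : Set (ZMod d)} [Fintype I]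
    (hI : IsOrbitReps (-1) I) (F : ZMod d → ℂ) (hF : ∀ x, F (-x) = F x) :
    ∑ a : I, (orbSize (-1) (a : ZMod d) : ℂ) * F a = ∑ x, F x := by
  classical
  rw [← Finset.sum_fiberwise (s := Finset.univ) (g := hI.rep) (f := F)]
  refine Finset.sum_congr rfl fun a _ => ?_
  have hset : (Finset.univ.filter fun x => hI.rep x = a) = {(a : ZMod d), -(a : ZMod d)} := by
    ext x
    simp only [Finset.mem_filter, Finset.mem_univ, true_and, Finset.mem_insert,
      Finset.mem_singleton]
    constructor
    · rintro rfl
      rcases hI.rep_eq_or_neg x with h | h <;> simp [h]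
    · rintro (h | h) <;> exact (hI.eq_rep (by simp [h])).symm
  rw [hset]
  by_cases h : -(a : ZMod d) = a
  · simp [h, orbSize_neg_one_of_neg_eq h]
  · rw [orbSize_neg_one_of_neg_ne h, Finset.sum_pair (Ne.symm h), hF]
    push_cast
    ring

/-! ### The irreducible characters of the dihedral group -/

theorem Representation.isIrreducible_of_forall_toSubmodule_eq_top {G V : Type*} [Group G]
    [AddCommGroup V] [Module ℂ V] [Nontrivial V] (ρ : Representation ℂ G V)
    (h : ∀ W : Subrepresentation ρ, ∀ v ∈ W.toSubmodule, v ≠ 0 → W.toSubmodule = ⊤) :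
    ρ.IsIrreducible := by
  have : Nontrivial (Subrepresentation ρ) := by
    refine ⟨⊥, ⊤, fun heq => ?_⟩
    have : (⊥ : Submodule ℂ V) = ⊤ := congrArg Subrepresentation.toSubmodule heq
    exact bot_ne_top this
  refine ⟨fun W => ?_⟩
  by_cases hW : W.toSubmodule = ⊥
  · exact Or.inl (Subrepresentation.toSubmodule_injective hW)
  · obtain ⟨v, hv, hv0⟩ := (Submodule.ne_bot_iff _).1 hW
    exact Or.inr (Subrepresentation.toSubmodule_injective (h W v hv hv0))

namespace DihedralGroup

open ZMod

variable {d : ℕ} [NeZero d]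

/-- The irreducible character of the dihedral group that belongs to the orbit of `a ∈ ℤ/d` under
`±1` and, if this orbit is a single point, to the sign `(-1)^α`. -/
noncomputable def orbitChar (a : ZMod d) (α : ℕ) : DihedralGroup d → ℂ
  | r i => if -a = a then stdAddChar (a * i) else stdAddChar (a * i) + stdAddChar (-(a * i))
  | sr i => if -a = a then (-1) ^ α * stdAddChar (a * i) else 0

theorem orbitChar_r_of_neg_eq {a : ZMod d} (h : -a = a) (α : ℕ) (i : ZMod d) :
    orbitChar a α (r i) = stdAddChar (a * i) := if_pos h

theorem orbitChar_r_of_neg_ne {a : ZMod d} (h : -a ≠ a) (α : ℕ) (i : ZMod d) :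
    orbitChar a α (r i) = stdAddChar (a * i) + stdAddChar (-(a * i)) := if_neg h

theorem orbitChar_sr_of_neg_eq {a : ZMod d} (h : -a = a) (α : ℕ) (i : ZMod d) :
    orbitChar a α (sr i) = (-1) ^ α * stdAddChar (a * i) := if_pos h

theorem orbitChar_sr_of_neg_ne {a : ZMod d} (h : -a ≠ a) (α : ℕ) (i : ZMod d) :
    orbitChar a α (sr i) = 0 := if_neg h

/-- A formula for both kinds of orbit: if `-a = a` the two summands coincide and the factor `1/2`
compensates. -/
theorem orbitChar_r (a : ZMod d) (α : ℕ) (i : ZMod d) :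
    orbitChar a α (r i) =
      (orbSize (-1) a / 2 : ℂ) * (stdAddChar (a * i) + stdAddChar (-(a * i))) := by
  by_cases h : -a = a
  · rw [orbitChar_r_of_neg_eq h, orbSize_neg_one_of_neg_eq h, ← neg_mul, h]
    push_cast
    ring
  · rw [orbitChar_r_of_neg_ne h, orbSize_neg_one_of_neg_ne h]
    push_cast
    ring

theorem orbitChar_one (a : ZMod d) (α : ℕ) : orbitChar a α 1 = orbSize (-1) a := by
  rw [one_def, orbitChar_r, mul_zero, neg_zero, AddChar.map_zero_eq_one]
  ring

theorem orbitChar_neg (a : ZMod d) (α : ℕ) : orbitChar (-a) α = orbitChar a α := by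
  by_cases h : -a = a
  · rw [h]
  · have h' : - -a ≠ -a := by simpa [eq_comm] using h
    funext g
    cases g with
    | r i => rw [orbitChar_r_of_neg_ne h, orbitChar_r_of_neg_ne h', neg_mul, neg_neg, add_comm]
    | sr i => rw [orbitChar_sr_of_neg_ne h, orbitChar_sr_of_neg_ne h']

theorem conj_orbitChar (a : ZMod d) (α : ℕ) (g : DihedralGroup d) :
    (starRingEnd ℂ) (orbitChar a α g) = orbitChar a α g⁻¹ := by
  have hconj (x : ZMod d) : (starRingEnd ℂ) (stdAddChar x) = stdAddChar (-x) :=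
    (AddChar.map_neg_eq_conj _ _).symm
  by_cases h : -a = a
  · cases g with
    | r i => rw [inv_r, orbitChar_r_of_neg_eq h, orbitChar_r_of_neg_eq h, hconj, mul_neg]
    | sr i =>
      rw [inv_sr, orbitChar_sr_of_neg_eq h, map_mul, hconj, ← neg_mul, h]
      simp
  · cases g with
    | r i =>
      rw [inv_r, orbitChar_r_of_neg_ne h, orbitChar_r_of_neg_ne h, map_add, hconj, hconj, mul_neg]
    | sr i => rw [inv_sr, orbitChar_sr_of_neg_ne h, map_zero]

/-- The one-dimensional representations of the dihedral group. -/
noncomputable def orbitRepOne (a : ZMod d) (h : -a = a) (α : ℕ) :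
    Representation ℂ (DihedralGroup d) ℂ where
  toFun g := orbitChar a α g • LinearMap.id
  map_one' := by
    rw [orbitChar_one, orbSize_neg_one_of_neg_eq h]
    simp
    rfl
  map_mul' g g' := by
    have hneg (i : ZMod d) : -(a * i) = a * i := by rw [← neg_mul, h]
    have hsub (i j : ZMod d) : a * (j - i) = a * i + a * j := by
      rw [mul_sub, sub_eq_add_neg, hneg, add_comm]
    have hsgn : ((-1 : ℂ) ^ α) * (-1) ^ α = 1 := by rw [← mul_pow]; simp
    have key : orbitChar a α (g * g') = orbitChar a α g * orbitChar a α g' := by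
      cases g <;> cases g' <;>
        simp only [r_mul_r, r_mul_sr, sr_mul_r, sr_mul_sr, orbitChar_r_of_neg_eq h,
          orbitChar_sr_of_neg_eq h, hsub, mul_add, AddChar.map_add_eq_mul]
      · ring
      · ring
      · rename_i i j
        linear_combination (-(stdAddChar (a * i) * stdAddChar (a * j) : ℂ)) * hsgn
    rw [key]
    ext
    simp [mul_comm]

theorem character_orbitRepOne (a : ZMod d) (h : -a = a) (α : ℕ) :
    (orbitRepOne a h α).character = orbitChar a α := by
  funext g
  rw [Representation.character]
  change LinearMap.trace ℂ ℂ (orbitChar a α g • LinearMap.id) = _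
  simp

theorem isIrreducible_orbitRepOne (a : ZMod d) (h : -a = a) (α : ℕ) :
    (orbitRepOne a h α).IsIrreducible := by
  refine Representation.isIrreducible_of_forall_toSubmodule_eq_top _ fun W v hv hv0 => ?_
  rw [Submodule.eq_top_iff']
  intro x
  have := W.toSubmodule.smul_mem (x / v) hv
  rwa [smul_eq_mul, div_mul_cancel₀ _ hv0] at this

/-- The matrices of the two-dimensional representation of the dihedral group attached to `a`. -/
noncomputable def orbitMatrix (a : ZMod d) : DihedralGroup d → Matrix (Fin 2) (Fin 2) ℂ
  | r i => !![stdAddChar (a * i), 0; 0, stdAddChar (-(a * i))]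
  | sr i => !![0, stdAddChar (-(a * i)); stdAddChar (a * i), 0]

theorem orbitMatrix_r_mulVec (a i : ZMod d) (x y : ℂ) :
    (orbitMatrix a (r i)).mulVec ![x, y] =
      ![stdAddChar (a * i) * x, stdAddChar (-(a * i)) * y] := by
  ext j
  fin_cases j <;> simp [orbitMatrix, Matrix.mulVec, dotProduct, Fin.sum_univ_two]

theorem orbitMatrix_sr_mulVec (a i : ZMod d) (x y : ℂ) :
    (orbitMatrix a (sr i)).mulVec ![x, y] =
      ![stdAddChar (-(a * i)) * y, stdAddChar (a * i) * x] := by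
  ext j
  fin_cases j <;> simp [orbitMatrix, Matrix.mulVec, dotProduct, Fin.sum_univ_two]

/-- The two-dimensional representation of the dihedral group attached to `a`. -/
noncomputable def orbitRepTwo (a : ZMod d) :
    Representation ℂ (DihedralGroup d) (Fin 2 → ℂ) where
  toFun g := Matrix.toLin' (orbitMatrix a g)
  map_one' := by
    rw [one_def, orbitMatrix]
    simp [← Matrix.one_fin_two]
    rfl
  map_mul' g g' := by
    have key : orbitMatrix a (g * g') = orbitMatrix a g * orbitMatrix a g' := by
      cases g <;> cases g' <;>
        simp [orbitMatrix, ← AddChar.map_add_eq_mul, mul_add,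
          sub_eq_add_neg, add_comm]
    rw [key, Matrix.toLin'_mul]
    rfl

theorem character_orbitRepTwo (a : ZMod d) (h : -a ≠ a) (α : ℕ) :
    (orbitRepTwo a).character = orbitChar a α := by
  funext g
  rw [Representation.character]
  change LinearMap.trace ℂ _ (Matrix.toLin' (orbitMatrix a g)) = _
  rw [Matrix.trace_toLin'_eq]
  cases g with
  | r i => simp [orbitMatrix, orbitChar_r_of_neg_ne h, Matrix.trace_fin_two]
  | sr i => simp [orbitMatrix, orbitChar_sr_of_neg_ne h, Matrix.trace_fin_two]

/-- `r 1` is diagonal with distinct eigenvalues, so an invariant subspace containing a vector with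
nonzero first coordinate contains the first basis vector; `sr 0` swaps the coordinates. -/
theorem isIrreducible_orbitRepTwo (a : ZMod d) (h : -a ≠ a) :
    (orbitRepTwo a).IsIrreducible := by
  refine Representation.isIrreducible_of_forall_toSubmodule_eq_top _ fun W v hv hv0 => ?_
  have happ (g : DihedralGroup d) (w : Fin 2 → ℂ) (hw : w ∈ W.toSubmodule) :
      (orbitMatrix a g).mulVec w ∈ W.toSubmodule := W.apply_mem_toSubmodule g hw
  have hne : (stdAddChar a : ℂ) - stdAddChar (-a) ≠ 0 :=
    sub_ne_zero.2 fun he => h (injective_stdAddChar he).symm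
  have hswap (x y : ℂ) (hw : ![x, y] ∈ W.toSubmodule) : ![y, x] ∈ W.toSubmodule := by
    have := happ (sr 0) _ hw
    rw [orbitMatrix_sr_mulVec] at this
    simpa using this
  have hfst (x y : ℂ) (hx : x ≠ 0) (hw : ![x, y] ∈ W.toSubmodule) :
      W.toSubmodule = ⊤ := by
    -- Subtracting the second eigenvalue of `r 1` kills the second coordinate.
    have h1 := W.toSubmodule.sub_mem (happ (r 1) _ hw)
      (W.toSubmodule.smul_mem (stdAddChar (-a)) hw)
    have h2 : ![1, 0] ∈ W.toSubmodule := by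
      have := W.toSubmodule.smul_mem (((stdAddChar a : ℂ) - stdAddChar (-a)) * x)⁻¹ h1
      rw [orbitMatrix_r_mulVec, mul_one] at this
      convert this using 1
      ext i
      fin_cases i
      · simp
        field_simp
      · simp
    rw [Submodule.eq_top_iff']
    intro w
    have := W.toSubmodule.add_mem (W.toSubmodule.smul_mem (w 0) h2)
      (W.toSubmodule.smul_mem (w 1) (hswap _ _ h2))
    convert this using 1
    ext i
    fin_cases i <;> simp
  have hv' : v = ![v 0, v 1] := by
    ext i
    fin_cases i <;> rfl
  rw [hv'] at hv
  by_cases hx : v 0 = 0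
  · refine hfst _ _ (fun hy => hv0 ?_) (hswap _ _ hv)
    rw [hv', hx, hy]
    ext i
    fin_cases i <;> rfl
  · exact hfst _ _ hx hv

theorem orbitChar_mem_irredChars (a : ZMod d) (α : ℕ) :
    orbitChar a α ∈ irredChars (DihedralGroup d) := by
  by_cases h : -a = a
  · exact ⟨ℂ, _, _, inferInstance, orbitRepOne a h α, isIrreducible_orbitRepOne a h α,
      character_orbitRepOne a h α⟩
  · exact ⟨Fin 2 → ℂ, _, _, inferInstance, orbitRepTwo a, isIrreducible_orbitRepTwo a h,
      character_orbitRepTwo a h α⟩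

end DihedralGroup

/-! ### Orthogonality and completeness of the list of characters. -/

theorem Representation.IsIrreducible.finrank_ne_zero {G V : Type*} [Group G] [AddCommGroup V]
    [Module ℂ V] [FiniteDimensional ℂ V] {ρ : Representation ℂ G V} (h : ρ.IsIrreducible) :
    Module.finrank ℂ V ≠ 0 := by
  intro h0
  have hs : Subsingleton V := Module.finrank_zero_iff.1 h0
  obtain ⟨W, W', hne⟩ := h.toNontrivial
  refine hne (Subrepresentation.toSubmodule_injective ?_)
  exact Subsingleton.elim _ _

namespace DihedralGroup

open ZMod

variable {d : ℕ} [NeZero d]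

open Classical in
theorem charInner_orbitChar (θ : DihedralGroup d → ℂ) (hθ : θ ∈ irredChars (DihedralGroup d))
    (a : ZMod d) (α : ℕ) :
    charInner θ (orbitChar a α) = if θ = orbitChar a α then 1 else 0 := by
  have hinv : Invertible ((Nat.card (DihedralGroup d) : ℕ) : ℂ) :=
    invertibleOfNonzero (Nat.cast_ne_zero.2 Nat.card_pos.ne')
  have key {V W : Type} [AddCommGroup V] [Module ℂ V] [FiniteDimensional ℂ V]
      [AddCommGroup W] [Module ℂ W] [FiniteDimensional ℂ W]
      (ρ : Representation ℂ (DihedralGroup d) V) (σ : Representation ℂ (DihedralGroup d) W)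
      (hρ : ρ.IsIrreducible) (hσ : σ.IsIrreducible) (hχ : σ.character = orbitChar a α) :
      charInner ρ.character (orbitChar a α) = if Nonempty (σ.Equiv ρ) then 1 else 0 := by
    rw [← Representation.char_orthonormal ρ σ, charInner, Nat.card_eq_fintype_card, hχ]
    simp only [conj_orbitChar]
  obtain ⟨V, _, _, _, ρ, hρ, rfl⟩ := hθ
  obtain ⟨W, _, _, _, σ, hσ, hχ⟩ := orbitChar_mem_irredChars a α
  rw [key ρ σ hρ hσ hχ]
  by_cases he : Nonempty (σ.Equiv ρ)
  · rw [if_pos he, if_pos]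
    rw [← hχ]
    exact (Representation.char_iso he.some).symm
  · rw [if_neg he, if_neg]
    -- Equal characters of inequivalent representations would have scalar product both 0 and 1.
    intro hc
    have h0 := key ρ σ hρ hσ hχ
    have h1 := key σ σ hσ hσ hχ
    rw [if_neg he] at h0
    rw [if_pos ⟨Representation.Equiv.refl σ⟩, hχ, ← hc] at h1
    rw [← hc] at h0
    exact zero_ne_one (h0.symm.trans h1)

/-- Summing over all signs removes the distinction between the two kinds of orbit. -/
theorem sum_range_stabSize_orbitChar_r (c i : ZMod d) :
    ∑ γ ∈ Finset.range (stabSize (-1) 2 c), orbitChar c γ (r i) =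
      stdAddChar (c * i) + stdAddChar (-(c * i)) := by
  by_cases h : -c = c
  · rw [stabSize_neg_one_of_neg_eq h, Finset.sum_range_succ, Finset.sum_range_one,
      orbitChar_r_of_neg_eq h, orbitChar_r_of_neg_eq h, ← neg_mul, h]
  · rw [stabSize_neg_one_of_neg_ne h, Finset.sum_range_one, orbitChar_r_of_neg_ne h]

theorem sum_range_stabSize_orbitChar_sr (c i : ZMod d) :
    ∑ γ ∈ Finset.range (stabSize (-1) 2 c), orbitChar c γ (sr i) = 0 := by
  by_cases h : -c = c
  · rw [stabSize_neg_one_of_neg_eq h, Finset.sum_range_succ, Finset.sum_range_one,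
      orbitChar_sr_of_neg_eq h, orbitChar_sr_of_neg_eq h]
    ring
  · rw [stabSize_neg_one_of_neg_ne h, Finset.sum_range_one, orbitChar_sr_of_neg_ne h]

section

variable {I : Set (ZMod d)}

/-- The right side is the regular character. On rotations the sum over orbits unfolds to sums of
additive characters over `ℤ/d`; on reflections the opposite signs cancel. -/
theorem sum_orbSize_mul_orbitChar [Fintype I] (hI : IsOrbitReps (-1) I) (g : DihedralGroup d) :
    ∑ p : CharIndex (-1) 2 I, (orbSize (-1) (p.1 : ZMod d) : ℂ) * orbitChar (p.1 : ZMod d) p.2 g =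
      if g = 1 then 2 * (d : ℂ) else 0 := by
  rw [Fintype.sum_sigma]
  simp only [← Finset.mul_sum]
  simp only [fun a : I => Fin.sum_univ_eq_sum_range (fun γ => orbitChar (a : ZMod d) γ g)
    (stabSize (-1) 2 (a : ZMod d))]
  cases g with
  | r i =>
    simp only [sum_range_stabSize_orbitChar_r]
    rw [hI.sum_orbSize_mul (fun x => stdAddChar (x * i) + stdAddChar (-(x * i)))
      fun x => by rw [neg_mul, neg_neg, add_comm], Finset.sum_add_distrib]
    simp only [← mul_neg]
    rw [AddChar.sum_mulShift i (isPrimitive_stdAddChar d),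
      AddChar.sum_mulShift (-i) (isPrimitive_stdAddChar d)]
    by_cases hi : i = 0
    · simp [hi, two_mul, r_zero]
    · have : r i ≠ (1 : DihedralGroup d) := fun h => hi (r.inj h)
      rw [if_neg this]
      simp [hi]
  | sr i =>
    simp only [sum_range_stabSize_orbitChar_sr]
    have : sr i ≠ (1 : DihedralGroup d) := fun h => by cases h
    rw [if_neg this]
    simp

theorem sum_orbSize_sq [Fintype I] (hI : IsOrbitReps (-1) I) :
    ∑ p : CharIndex (-1) 2 I, orbSize (-1) (p.1 : ZMod d) ^ 2 = 2 * d := by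
  have := sum_orbSize_mul_orbitChar hI 1
  simp only [orbitChar_one, if_true] at this
  have h2 : ((∑ p : CharIndex (-1) 2 I, orbSize (-1) (p.1 : ZMod d) ^ 2 : ℕ) : ℂ) =
      ((2 * d : ℕ) : ℂ) := by
    push_cast
    rw [← this]
    exact Finset.sum_congr rfl fun p _ => sq _
  exact_mod_cast h2

/-- Pairing `θ` with the regular character gives `θ 1 ≠ 0`, whereas a character off the list would
be orthogonal to every summand. -/
theorem exists_eq_orbitChar (hI : IsOrbitReps (-1) I) {θ : DihedralGroup d → ℂ}
    (hθ : θ ∈ irredChars (DihedralGroup d)) :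
    ∃ p : CharIndex (-1) 2 I, orbitChar (p.1 : ZMod d) p.2 = θ := by
  classical
  have hfin : Fintype I := Fintype.ofFinite I
  by_contra! hne
  have h1 : θ 1 ≠ 0 := by
    obtain ⟨V, _, _, _, ρ, hρ, rfl⟩ := hθ
    rw [Representation.char_one]
    exact Nat.cast_ne_zero.2 hρ.finrank_ne_zero
  have hd : (d : ℂ) ≠ 0 := Nat.cast_ne_zero.2 (NeZero.ne d)
  have h0 : ∑ p : CharIndex (-1) 2 I,
      (orbSize (-1) (p.1 : ZMod d) : ℂ) * charInner θ (orbitChar (p.1 : ZMod d) p.2) = 0 := by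
    refine Finset.sum_eq_zero fun p _ => ?_
    rw [charInner_orbitChar θ hθ, if_neg (hne p).symm, mul_zero]
  have h2 : ∑ p : CharIndex (-1) 2 I,
      (orbSize (-1) (p.1 : ZMod d) : ℂ) * charInner θ (orbitChar (p.1 : ZMod d) p.2) = θ 1 := by
    simp only [charInner, conj_orbitChar, Finset.mul_sum]
    rw [Finset.sum_comm]
    have hterm (g : DihedralGroup d) : ∑ p : CharIndex (-1) 2 I,
        (orbSize (-1) (p.1 : ZMod d) : ℂ) * ((Fintype.card (DihedralGroup d) : ℂ)⁻¹ *
          (θ g * orbitChar (p.1 : ZMod d) p.2 g⁻¹)) = if g = 1 then θ 1 else 0 := by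
      have : ∀ p : CharIndex (-1) 2 I,
          (orbSize (-1) (p.1 : ZMod d) : ℂ) * ((Fintype.card (DihedralGroup d) : ℂ)⁻¹ *
            (θ g * orbitChar (p.1 : ZMod d) p.2 g⁻¹)) =
          ((Fintype.card (DihedralGroup d) : ℂ)⁻¹ * θ g) *
            ((orbSize (-1) (p.1 : ZMod d) : ℂ) * orbitChar (p.1 : ZMod d) p.2 g⁻¹) :=
        fun p => by ring
      simp only [this]
      rw [← Finset.mul_sum, sum_orbSize_mul_orbitChar hI, card]
      by_cases hg : g = 1
      · subst hg
        simp only [inv_one, if_true]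
        push_cast
        field_simp
      · simp [hg]
    simp [hterm]
  exact h1 (h2.symm.trans h0)

/-- The degree tells the kind of orbit, the value at `r 1` gives `a` up to sign, and the value at
`sr 0` gives the sign `(-1) ^ α` when there is a choice. -/
theorem orbitChar_injective (hI : IsOrbitReps (-1) I) :
    Function.Injective fun p : CharIndex (-1) 2 I =>
      (orbitChar (p.1 : ZMod d) p.2 : DihedralGroup d → ℂ) := by
  rintro ⟨a, α⟩ ⟨b, β⟩ h
  have hone := congrFun h 1
  have hr := congrFun h (r 1)
  have hsr := congrFun h (sr 0)
  simp only [orbitChar_one, Nat.cast_inj] at hone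
  dsimp only at hr hsr
  by_cases ha : -(a : ZMod d) = a
  · have hb : -(b : ZMod d) = b := by
      by_contra hb
      rw [orbSize_neg_one_of_neg_eq ha, orbSize_neg_one_of_neg_ne hb] at hone
      omega
    rw [orbitChar_r_of_neg_eq ha, orbitChar_r_of_neg_eq hb, mul_one, mul_one] at hr
    obtain rfl : a = b := Subtype.ext (injective_stdAddChar hr)
    rw [orbitChar_sr_of_neg_eq ha, orbitChar_sr_of_neg_eq ha] at hsr
    have hα := α.2.trans_eq (stabSize_neg_one_of_neg_eq ha)
    have hβ := β.2.trans_eq (stabSize_neg_one_of_neg_eq ha)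
    have : (α : ℕ) = β := by
      generalize (α : ℕ) = x at *
      generalize (β : ℕ) = y at *
      interval_cases x <;> interval_cases y <;> first | rfl | norm_num at hsr
    rw [Fin.ext this]
  · have hb : -(b : ZMod d) ≠ b := by
      intro hb
      rw [orbSize_neg_one_of_neg_eq hb, orbSize_neg_one_of_neg_ne ha] at hone
      omega
    rw [orbitChar_r_of_neg_ne ha, orbitChar_r_of_neg_ne hb, mul_one, mul_one,
      AddChar.map_neg_eq_inv, AddChar.map_neg_eq_inv] at hr
    have hab : (a : ZMod d) = b ∨ (a : ZMod d) = -b := by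
      have hz : (stdAddChar (a : ZMod d) : ℂ) ≠ 0 := (AddChar.val_isUnit _ _).ne_zero
      have hw : (stdAddChar (b : ZMod d) : ℂ) ≠ 0 := (AddChar.val_isUnit _ _).ne_zero
      -- `z + z⁻¹ = w + w⁻¹` amounts to `(z - w) * (z * w - 1) = 0`.
      have hfac : ((stdAddChar (a : ZMod d) : ℂ) - stdAddChar (b : ZMod d)) *
          (stdAddChar (a : ZMod d) * stdAddChar (b : ZMod d) - 1) = 0 := by
        field_simp at hr
        linear_combination hr
      rcases mul_eq_zero.1 hfac with h | h
      · exact Or.inl (injective_stdAddChar (sub_eq_zero.1 h))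
      · right
        apply injective_stdAddChar (N := d)
        rw [AddChar.map_neg_eq_inv]
        exact eq_inv_of_mul_eq_one_left (sub_eq_zero.1 h)
    obtain rfl : a = b := (hI.eq_rep hab).trans (hI.eq_rep (Or.inl rfl)).symm
    have hα := α.2.trans_eq (stabSize_neg_one_of_neg_ne ha)
    have hβ := β.2.trans_eq (stabSize_neg_one_of_neg_ne ha)
    have : (α : ℕ) = β := by omega
    rw [Fin.ext this]

/-- The irreducible characters of the dihedral group are indexed by the pairs `(a, α)`. -/
noncomputable def orbitCharEquiv (hI : IsOrbitReps (-1) I) :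
    CharIndex (-1) 2 I ≃ irredChars (DihedralGroup d) :=
  Equiv.ofBijective (fun p => ⟨orbitChar (p.1 : ZMod d) p.2, orbitChar_mem_irredChars _ _⟩)
    ⟨fun _ _ h => orbitChar_injective hI (congrArg Subtype.val h), fun θ =>
      (exists_eq_orbitChar hI θ.2).imp fun _ h => Subtype.ext h⟩

theorem coe_orbitCharEquiv (hI : IsOrbitReps (-1) I) (p : CharIndex (-1) 2 I) :
    (orbitCharEquiv hI p : DihedralGroup d → ℂ) = orbitChar (p.1 : ZMod d) p.2 := rfl

end

end DihedralGroup

/-! ### Products of characters and structure constants. -/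

theorem gammaCond_zero_iff {d : ℕ} {k : ℤ} {m : ℕ} (a b c : ZMod d) (α β γ : ℕ) :
    GammaCond k 0 m a b c α β γ ↔
      ((Nat.gcd (stabSize k m a) (stabSize k m b) : ℕ) : ℤ) ∣ (α : ℤ) + β - γ := by
  simp only [GammaCond, fracPart, Int.cast_zero, mul_zero, zero_div, Int.fract_zero, add_zero,
    sub_zero]
  constructor
  · rintro ⟨t, ht⟩
    exact ⟨t, by rw [mul_comm]; exact_mod_cast ht⟩
  · rintro ⟨t, ht⟩
    exact ⟨t, by rw [mul_comm] at ht; exact_mod_cast ht⟩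

theorem IsOrbitReps.stabSize_rep {d : ℕ} {I : Set (ZMod d)} (hI : IsOrbitReps (-1) I)
    (c : ZMod d) :
    stabSize (-1) 2 (hI.rep c : ZMod d) = stabSize (-1) 2 c := by
  rcases hI.rep_eq_or_neg c with h | h
  · rw [h]
  · rw [h]
    by_cases hc : -c = c
    · rw [hc]
    · rw [stabSize_neg_one_of_neg_ne hc, stabSize_neg_one_of_neg_ne (by simpa [eq_comm] using hc)]

theorem IsOrbitReps.orbSize_rep {d : ℕ} {I : Set (ZMod d)} (hI : IsOrbitReps (-1) I)
    (c : ZMod d) :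
    orbSize (-1) (hI.rep c : ZMod d) = orbSize (-1) c := by
  have h := stabSize_mul_orbSize_neg_one c
  have h' := stabSize_mul_orbSize_neg_one (hI.rep c : ZMod d)
  rw [hI.stabSize_rep] at h'
  have hs : stabSize (-1) 2 c ≠ 0 := fun h0 => by
    rw [h0, zero_mul] at h
    omega
  exact Nat.eq_of_mul_eq_mul_left (Nat.pos_of_ne_zero hs) (h'.trans h.symm)

open Classical in
/-- The coefficient of the third subset in the product of the first two. -/
noncomputable def orbitCoeff {d : ℕ} {I : Set (ZMod d)} (hI : IsOrbitReps (-1) I)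
    (p q t : CharIndex (-1) 2 I) : ℚ :=
  ((orbSize (-1) (p.1 : ZMod d) *
      Nat.gcd (orbSize (-1) (p.1 : ZMod d)) (orbSize (-1) (q.1 : ZMod d)) : ℕ) : ℚ) *
    ∑ i ∈ Finset.range (orbSize (-1) (q.1 : ZMod d)),
      ∑ γ : Fin (stabSize (-1) 2 (hI.rep ((p.1 : ZMod d) + (q.1 : ZMod d) * (-1) ^ i) : ZMod d)),
        if GammaCond (-1) 0 2 (p.1 : ZMod d) (q.1 : ZMod d)
            (hI.rep ((p.1 : ZMod d) + (q.1 : ZMod d) * (-1) ^ i) : ZMod d) p.2 q.2 γ then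
          (orbSize (-1) ((p.1 : ZMod d) + (q.1 : ZMod d) * (-1) ^ i) : ℚ)⁻¹ *
            if (⟨hI.rep ((p.1 : ZMod d) + (q.1 : ZMod d) * (-1) ^ i), γ⟩ :
              CharIndex (-1) 2 I) = t then 1 else 0
        else 0

open Classical in
theorem sum_orbitCoeff_smul {d : ℕ} {I : Set (ZMod d)} [Fintype I] {M : Type*}
    [AddCommGroup M] [Module ℚ M]
    (hI : IsOrbitReps (-1) I) (S : CharIndex (-1) 2 I → M) (a b : I)
    (α : Fin (stabSize (-1) 2 (a : ZMod d))) (β : Fin (stabSize (-1) 2 (b : ZMod d))) :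
    ∑ t, orbitCoeff hI ⟨a, α⟩ ⟨b, β⟩ t • S t =
      ((orbSize (-1) (a : ZMod d) *
          Nat.gcd (orbSize (-1) (a : ZMod d)) (orbSize (-1) (b : ZMod d)) : ℕ) : ℚ) •
        ∑ i ∈ Finset.range (orbSize (-1) (b : ZMod d)),
          ∑ γ : Fin (stabSize (-1) 2 (hI.rep ((a : ZMod d) + (b : ZMod d) * (-1) ^ i) : ZMod d)),
            if GammaCond (-1) 0 2 (a : ZMod d) (b : ZMod d)
                (hI.rep ((a : ZMod d) + (b : ZMod d) * (-1) ^ i) : ZMod d) α β γ then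
              (orbSize (-1) ((a : ZMod d) + (b : ZMod d) * (-1) ^ i) : ℚ)⁻¹ •
                S ⟨hI.rep ((a : ZMod d) + (b : ZMod d) * (-1) ^ i), γ⟩
            else 0 := by
  simp only [orbitCoeff, mul_smul, ← Finset.smul_sum, Finset.sum_smul]
  congr 1
  rw [Finset.sum_comm]
  refine Finset.sum_congr rfl fun i _ => ?_
  rw [Finset.sum_comm]
  refine Finset.sum_congr rfl fun γ _ => ?_
  split_ifs with h
  · simp
  · simp

namespace DihedralGroup

open ZMod

variable {d : ℕ} [NeZero d] {I : Set (ZMod d)}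

theorem orbitChar_rep (hI : IsOrbitReps (-1) I) (c : ZMod d) (γ : ℕ) :
    orbitChar (hI.rep c : ZMod d) γ = orbitChar c γ := by
  rcases hI.rep_eq_or_neg c with h | h
  · rw [h]
  · rw [h, orbitChar_neg]

-- Here the gcd is 2, so exactly one of `γ = 0, 1` survives, the one with the parity of `α + β`.
open Classical in
theorem sum_gammaCond_orbitChar_of_neg_eq {a b c : ZMod d} (ha : -a = a) (hb : -b = b)
    (hc : -c = c) (α β : ℕ) :
    ∑ γ ∈ Finset.range (stabSize (-1) 2 c),
      (if GammaCond (-1) 0 2 a b c α β γ then orbitChar c γ else 0) = orbitChar c (α + β) := by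
  have hpar : ∀ m n : ℕ, m % 2 = n % 2 → orbitChar c m = orbitChar c n := by
    intro m n hmn
    have hs : (-1 : ℂ) ^ m = (-1) ^ n := by
      rw [neg_one_pow_eq_pow_mod_two, hmn, ← neg_one_pow_eq_pow_mod_two]
    funext g
    cases g with
    | r i => rw [orbitChar_r_of_neg_eq hc, orbitChar_r_of_neg_eq hc]
    | sr i => rw [orbitChar_sr_of_neg_eq hc, orbitChar_sr_of_neg_eq hc, hs]
  simp only [gammaCond_zero_iff, stabSize_neg_one_of_neg_eq ha, stabSize_neg_one_of_neg_eq hb,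
    stabSize_neg_one_of_neg_eq hc, Finset.sum_range_succ, Finset.sum_range_zero, zero_add]
  rcases Nat.mod_two_eq_zero_or_one (α + β) with h | h
  · rw [if_pos (by norm_num; omega), if_neg (by norm_num; omega), add_zero,
      hpar _ _ (h.trans (Nat.zero_mod 2).symm)]
  · rw [if_neg (by norm_num; omega), if_pos (by norm_num; omega), zero_add, hpar _ 1 h]

-- An orbit of size 2 has trivial stabilizer, so the gcd is 1 and the congruence is vacuous.
open Classical in
theorem sum_gammaCond_orbitChar_of_neg_ne {a b : ZMod d} (hab : -a ≠ a ∨ -b ≠ b)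
    (c : ZMod d) (α β : ℕ) :
    ∑ γ ∈ Finset.range (stabSize (-1) 2 c),
      (if GammaCond (-1) 0 2 a b c α β γ then orbitChar c γ else 0) =
    ∑ γ ∈ Finset.range (stabSize (-1) 2 c), (orbitChar c γ : DihedralGroup d → ℂ) := by
  have hg : Nat.gcd (stabSize (-1) 2 a) (stabSize (-1) 2 b) = 1 := by
    rcases hab with h | h <;> simp [stabSize_neg_one_of_neg_ne h]
  refine Finset.sum_congr rfl fun γ _ => if_pos ?_
  rw [gammaCond_zero_iff, hg]
  exact one_dvd _

-- The factor `gcd(r_a, r_b) / r_b` corrects an overcount. It differs from 1 only if `a` is fixed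
-- and `b` is not; then `a + b` and `a - b` lie in one orbit, which the sum over `i` meets twice.
open Classical in
theorem orbitChar_mul_orbitChar (a b : ZMod d) (α β : ℕ) :
    orbitChar a α * orbitChar b β =
      ((Nat.gcd (orbSize (-1) a) (orbSize (-1) b) : ℂ) / orbSize (-1) b) •
        ∑ i ∈ Finset.range (orbSize (-1) b),
          ∑ γ ∈ Finset.range (stabSize (-1) 2 (a + b * (-1) ^ i)),
            if GammaCond (-1) 0 2 a b (a + b * (-1) ^ i) α β γ then
              orbitChar (a + b * (-1) ^ i) γ else 0 := by
  by_cases hab : -a = a ∧ -b = b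
  · obtain ⟨ha, hb⟩ := hab
    have hc : -(a + b) = a + b := by rw [neg_add, ha, hb]
    rw [orbSize_neg_one_of_neg_eq hb, Finset.sum_range_one, pow_zero, mul_one,
      sum_gammaCond_orbitChar_of_neg_eq ha hb hc]
    funext g
    cases g with
    | r i =>
      simp [orbitChar_r_of_neg_eq ha, orbitChar_r_of_neg_eq hb, orbitChar_r_of_neg_eq hc, add_mul,
        AddChar.map_add_eq_mul]
    | sr i =>
      simp [orbitChar_sr_of_neg_eq ha, orbitChar_sr_of_neg_eq hb, orbitChar_sr_of_neg_eq hc,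
        add_mul, AddChar.map_add_eq_mul, pow_add]
      ring
  · rw [not_and_or] at hab
    simp only [sum_gammaCond_orbitChar_of_neg_ne hab]
    funext g
    simp only [Pi.mul_apply, Pi.smul_apply, Finset.sum_apply, smul_eq_mul]
    cases g with
    | r j =>
      simp only [sum_range_stabSize_orbitChar_r]
      by_cases ha : -a = a
      · have hb : -b ≠ b := hab.resolve_left (not_not.2 ha)
        have haj : (stdAddChar (-(a * j)) : ℂ) = stdAddChar (a * j) := by rw [← neg_mul, ha]
        rw [orbSize_neg_one_of_neg_eq ha, orbSize_neg_one_of_neg_ne hb, Finset.sum_range_succ,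
          Finset.sum_range_one, orbitChar_r_of_neg_eq ha, orbitChar_r_of_neg_ne hb]
        simp only [pow_zero, pow_one, mul_one, mul_neg, add_mul, neg_add, neg_mul, neg_neg,
          AddChar.map_add_eq_mul, haj]
        norm_num
        ring
      · by_cases hb : -b = b
        · have hbj : (stdAddChar (-(b * j)) : ℂ) = stdAddChar (b * j) := by rw [← neg_mul, hb]
          rw [orbSize_neg_one_of_neg_ne ha, orbSize_neg_one_of_neg_eq hb,
            Finset.sum_range_one, orbitChar_r_of_neg_ne ha, orbitChar_r_of_neg_eq hb]
          simp only [pow_zero, mul_one, add_mul, neg_add, AddChar.map_add_eq_mul, hbj]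
          norm_num
        · rw [orbSize_neg_one_of_neg_ne ha, orbSize_neg_one_of_neg_ne hb, Finset.sum_range_succ,
            Finset.sum_range_one, orbitChar_r_of_neg_ne ha, orbitChar_r_of_neg_ne hb]
          simp only [pow_zero, pow_one, mul_one, mul_neg, add_mul, neg_add, neg_mul, neg_neg,
            AddChar.map_add_eq_mul]
          norm_num
          ring
    | sr j =>
      simp only [sum_range_stabSize_orbitChar_sr]
      rcases hab with h | h <;> simp [orbitChar_sr_of_neg_ne h]

theorem charInner_smul_left (z : ℂ) (θ φ : DihedralGroup d → ℂ) :
    charInner (z • θ) φ = z * charInner θ φ := by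
  simp only [charInner, Pi.smul_apply, smul_eq_mul, Finset.mul_sum]
  exact Finset.sum_congr rfl fun g _ => by ring

theorem charInner_sum_left {κ : Type*} (s : Finset κ) (θ : κ → DihedralGroup d → ℂ)
    (φ : DihedralGroup d → ℂ) :
    charInner (∑ x ∈ s, θ x) φ = ∑ x ∈ s, charInner (θ x) φ := by
  simp only [charInner, Finset.sum_apply, Finset.sum_mul, ← Finset.mul_sum]
  rw [Finset.sum_comm]

theorem charInner_zero_left (φ : DihedralGroup d → ℂ) : charInner 0 φ = 0 := by
  simp [charInner]

open Classical in
theorem charInner_orbitChar_mul (hI : IsOrbitReps (-1) I) (p q t : CharIndex (-1) 2 I) :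
    charInner (orbitChar (p.1 : ZMod d) p.2 * orbitChar (q.1 : ZMod d) q.2)
        (orbitChar (t.1 : ZMod d) t.2) =
      ((Nat.gcd (orbSize (-1) (p.1 : ZMod d)) (orbSize (-1) (q.1 : ZMod d)) : ℂ) /
          orbSize (-1) (q.1 : ZMod d)) *
        ∑ i ∈ Finset.range (orbSize (-1) (q.1 : ZMod d)),
          ∑ γ : Fin (stabSize (-1) 2
              (hI.rep ((p.1 : ZMod d) + (q.1 : ZMod d) * (-1) ^ i) : ZMod d)),
            if GammaCond (-1) 0 2 (p.1 : ZMod d) (q.1 : ZMod d)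
                (hI.rep ((p.1 : ZMod d) + (q.1 : ZMod d) * (-1) ^ i) : ZMod d) p.2 q.2 γ then
              if (⟨hI.rep ((p.1 : ZMod d) + (q.1 : ZMod d) * (-1) ^ i), γ⟩ :
                CharIndex (-1) 2 I) = t then 1 else 0
            else 0 := by
  rw [orbitChar_mul_orbitChar, charInner_smul_left, charInner_sum_left]
  congr 1
  refine Finset.sum_congr rfl fun i _ => ?_
  generalize (p.1 : ZMod d) + (q.1 : ZMod d) * (-1) ^ i = c
  rw [← hI.stabSize_rep c, ← Fin.sum_univ_eq_sum_range (fun γ =>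
    if GammaCond (-1) 0 2 (p.1 : ZMod d) (q.1 : ZMod d) c p.2 q.2 γ then orbitChar c γ else 0),
    charInner_sum_left]
  refine Finset.sum_congr rfl fun γ _ => ?_
  -- For `l = 0` the condition no longer mentions `c`, so replacing `c` by its representative does
  -- not affect it.
  simp only [gammaCond_zero_iff]
  split_ifs with _ h2
  · rw [← orbitChar_rep hI c, charInner_orbitChar _ (orbitChar_mem_irredChars _ _), ← h2,
      if_pos rfl]
  · rw [← orbitChar_rep hI c, charInner_orbitChar _ (orbitChar_mem_irredChars _ _), if_neg]
    exact fun h => h2 (orbitChar_injective hI h)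
  · exact charInner_zero_left _

theorem charMult_orbitCharEquiv (hI : IsOrbitReps (-1) I) (p q t : CharIndex (-1) 2 I) :
    charMult (orbitCharEquiv hI p) (orbitCharEquiv hI q) (orbitCharEquiv hI t) =
      ((orbitCoeff hI p q t * (orbSize (-1) (t.1 : ZMod d)) ^ 2 : ℚ) : ℂ) := by
  classical
  have hr (x : ZMod d) : (orbSize (-1) x : ℂ) ≠ 0 :=
    Nat.cast_ne_zero.2 (orbSize_neg_one_pos x).ne'
  simp only [charMult, coe_orbitCharEquiv, orbitChar_one]
  rw [charInner_orbitChar_mul hI, orbitCoeff]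
  push_cast
  -- The degree of the second character cancels the denominator `r_b`. One factor `r_t` remains,
  -- matching `r_t ^ 2` times the inverse of `r_c = r_t` in `orbitCoeff`.
  have hcoef (x y z g K : ℂ) (hy : y ≠ 0) : x * y * z * (g / y * K) = x * g * (K * z) := by
    field_simp
  rw [hcoef _ _ _ _ _ (hr _), mul_assoc (_ * _ : ℂ) _ (_ ^ 2)]
  congr 1
  simp only [Finset.sum_mul]
  refine Finset.sum_congr rfl fun i _ => Finset.sum_congr rfl fun γ _ => ?_
  split_ifs with _ h2
  · rw [← h2, hI.orbSize_rep]
    have := hr ((p.1 : ZMod d) + (q.1 : ZMod d) * (-1) ^ i)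
    push_cast
    field_simp
  · simp
  · simp

end DihedralGroup

open Classical in
/-- The dihedral group `D_d` of order `2 d` is `M(-1, 0, 2, d)`. -/
theorem mainTheorem9 (d : ℕ) [NeZero d] (I : Set (ZMod d)) (hI : IsOrbitReps (-1) I)
    (Q : Type*) [Mul Q] [IsQuasigroup Q] (hQ : Nat.card Q = 2 * d) :
    IsBalancedCover Q (DihedralGroup d) ↔
      ∃ S : CharIndex (-1) 2 I → Finset Q,
        (Pairwise fun p p' => Disjoint (S p) (S p')) ∧
        (∀ p : CharIndex (-1) 2 I, (S p).card = orbSize (-1) (p.1 : ZMod d) ^ 2) ∧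
        ∀ (a b : I) (α : Fin (stabSize (-1) 2 (a : ZMod d)))
          (β : Fin (stabSize (-1) 2 (b : ZMod d))),
          subsetSum (S ⟨a, α⟩) * subsetSum (S ⟨b, β⟩) =
            ((orbSize (-1) (a : ZMod d) *
                Nat.gcd (orbSize (-1) (a : ZMod d)) (orbSize (-1) (b : ZMod d)) : ℕ) : ℚ) •
              ∑ i ∈ Finset.range (orbSize (-1) (b : ZMod d)),
                ∑ γ : Fin (stabSize (-1) 2 (hI.rep ((a : ZMod d) + (b : ZMod d) * (-1) ^ i) : ZMod d)),
                  if GammaCond (-1) 0 2 (a : ZMod d) (b : ZMod d)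
                      (hI.rep ((a : ZMod d) + (b : ZMod d) * (-1) ^ i) : ZMod d) α β γ then
                    (orbSize (-1) ((a : ZMod d) + (b : ZMod d) * (-1) ^ i) : ℚ)⁻¹ •
                      subsetSum (S ⟨hI.rep ((a : ZMod d) + (b : ZMod d) * (-1) ^ i), γ⟩)
                  else 0 := by
  -- `Nat.card` is 0 on infinite types, so a nonzero value makes `Q` finite.
  have hpos : Nat.card Q ≠ 0 := by
    rw [hQ]
    exact mul_ne_zero two_ne_zero (NeZero.ne d)
  have hfin : Finite Q := (Nat.card_ne_zero.1 hpos).2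
  have hQfin : Fintype Q := Fintype.ofFinite Q
  rw [isBalancedCover_iff_exists_subsets (DihedralGroup.orbitCharEquiv hI)
    (fun p => orbSize (-1) (p.1 : ZMod d)) (fun p => orbSize_neg_one_pos _)
    (fun p => by rw [DihedralGroup.coe_orbitCharEquiv, DihedralGroup.orbitChar_one])
    (by rw [DihedralGroup.sum_orbSize_sq hI, ← hQ, Nat.card_eq_fintype_card])
    (orbitCoeff hI) (DihedralGroup.charMult_orbitCharEquiv hI)]
  refine exists_congr fun S => and_congr_right fun _ => and_congr_right fun _ => ?_
  simp only [← sum_orbitCoeff_smul hI (fun p => subsetSum (S p))]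
  exact ⟨fun h a b α β => h ⟨a, α⟩ ⟨b, β⟩, fun h p q => h p.1 q.1 p.2 q.2⟩
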